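/- Let $d\ge 1$, let $I$ be a finite set and let $(V_i)_{i\in I}$ be matrices in $M_d(\mathbb{C})$ with $\sum_{i} V_i^*V_i=\mathbf 1$. Put $\Phi(x)=\sum_{i} V_i^* x V_i$, and let $\Phi^*(x)=\sum_i V_i x V_i^*$ be its dual for the trace pairing $(x,y)\mapsto\mathrm{tr}(xy)$. A state is a positive semidefinite matrix of trace one. A quantum channel (a unital completely positive linear map on $M_d(\mathbb{C})$) is called irreducible if its dual has a unique invariant state and this state is positive definite. Assume that $\Phi$ is irreducible, with invariant state $\sigma>0$, $\Phi^*(\sigma)=\sigma$. Let $\langle x,y\rangle=\mathrm{tr}(\sigma^{1/2}x^*\sigma^{1/2}y)$ be the KMS inner product, $\|x\|_2=\langle x,x\rangle^{1/2}$, and let $\Phi^\dagger$ be the adjoint of $\Phi$ for this inner product, that is $\Phi^\dagger(x)=\sigma^{-1/2}\Phi^*(\sigma^{1/2}x\sigma^{1/2})\sigma^{-1/2}$. For a state $\rho$, the output process $(X_k)_{k\ge1}$ is the $I$-valued process with law $$\mathbb{P}_\rho(X_1=i_1,\dots,X_n=i_n)=\mathrm{tr}(V_{i_n}\cdots V_{i_1}\,\rho\,V_{i_1}^*\cdots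 V_{i_n}^*)\qquad(n\ge 1,\ i_1,\dots,i_n\in I).$$ For $g:I\to\mathbb{R}$ write $\pi(g)=\sum_{i} g(i)\,\pi(i)$ with $\pi(i)=\mathrm{tr}(\sigma V_i^*V_i)$. **Theorem.** Assume that the channel $\Psi:=\Phi^\dagger\Phi$ is irreducible, and let $\varepsilon=1-\max\{|\lambda|:\lambda\in\mathrm{Sp}(\Psi),\ \lambda\neq 1\}$ be its spectral gap (the maximum being $0$ if $\mathrm{Sp}(\Psi)=\{1\}$, i.e. if $d=1$). Let $f:I\to\mathbb{R}$ satisfy $\pi(f)=0$, $\pi(f^2)=b^2$ and $\|f\|_\infty=\max_{i\in I}|f(i)|=c$ for some $b,c>0$. Then for every state $\rho$, every $\gamma>0$ and every $n\ge1$, $$\mathbb{P}_\rho\Big(\frac1n\sum_{k=1}^n f(X_k)\ge\gamma\Big)\le N_\rho\,\exp\Big(-n\,\frac{\gamma^2\varepsilon}{6b^2}\,h\Big(\frac{10c\gamma}{3b^2}\Big)\Big),$$ where $N_\rho=\|\sigma^{-1/2}\rho\,\sigma^{-1/2}\|_2$ and $h(x)=(\sqrt{1+x}+x/2+1)^{-1}$.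 -/

import Mathlib

open Matrix MeasureTheory
open scoped MatrixOrder ComplexOrder

noncomputable section

namespace QMC

/-- The algebra `M_d(ℂ)` of complex `d × d` matrices. -/
abbrev Mat (d : ℕ) : Type := Matrix (Fin d) (Fin d) ℂ

/-- A state: a positive semidefinite matrix of unit trace. -/
def IsState {d : ℕ} (ρ : Mat d) : Prop := ρ.PosSemidef ∧ ρ.trace = 1

/-- The completely positive map `x ↦ ∑ i, V i ^* x V i` with Kraus operators `V` (the transition
operator in the Heisenberg picture). It is unital, i.e. a quantum channel, exactly when
`∑ i, V i ^* V i = 1`. -/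
def krausMap {d : ℕ} {I : Type*} [Fintype I] (V : I → Mat d) : Mat d →ₗ[ℂ] Mat d where
  toFun x := ∑ i, (V i)ᴴ * x * V i
  map_add' x y := by simp [mul_add, add_mul, Finset.sum_add_distrib]
  map_smul' a x := by simp [Finset.smul_sum]

/-- The dual `η^*` of a linear map on `M_d(ℂ)` for the pairing `(x, y) ↦ tr (x y)`; it is
characterized by `tr (x η(y)) = tr (η^*(x) y)`, see `trace_traceDual_mul`. -/
def traceDual {d : ℕ} (η : Mat d →ₗ[ℂ] Mat d) : Mat d →ₗ[ℂ] Mat d where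
  toFun x := Matrix.of fun i j => (x * η (Matrix.single j i 1)).trace
  map_add' x y := by ext i j; simp [add_mul]
  map_smul' a x := by ext i j; simp

theorem trace_traceDual_mul {d : ℕ} (η : Mat d →ₗ[ℂ] Mat d) (x y : Mat d) :
    (traceDual η x * y).trace = (x * η y).trace := by
  conv_rhs => rw [matrix_eq_sum_single y]
  have h : ∀ i j, (Matrix.single i j (y i j) : Mat d) = y i j • Matrix.single i j 1 := by
    intro i j; simp
  simp only [h, map_sum, map_smul, Finset.mul_sum, trace_sum, mul_smul_comm, trace_smul]
  simp only [Matrix.trace, Matrix.diag, Matrix.mul_apply, traceDual, LinearMap.coe_mk,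
    AddHom.coe_mk, Matrix.of_apply, smul_eq_mul]
  rw [Finset.sum_comm]
  exact Finset.sum_congr rfl fun i _ => Finset.sum_congr rfl fun j _ => mul_comm _ _

/-- `σ` is the unique invariant state of the dual of `η`, and it is faithful (`σ > 0`). -/
def IsUniqueFaithfulInvariantState {d : ℕ} (η : Mat d →ₗ[ℂ] Mat d) (σ : Mat d) : Prop :=
  IsState σ ∧ σ.PosDef ∧ traceDual η σ = σ ∧
    ∀ τ : Mat d, IsState τ → traceDual η τ = τ → τ = σ

/-- A quantum channel (in the Heisenberg picture) is irreducible when its dual has a unique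
invariant state and this state is faithful. -/
def IsIrreducible {d : ℕ} (η : Mat d →ₗ[ℂ] Mat d) : Prop :=
  ∃ σ : Mat d, IsUniqueFaithfulInvariantState η σ

/-- The KMS inner product `⟨x, y⟩ = tr (σ^{1/2} x^* σ^{1/2} y)`. -/
def kmsInner {d : ℕ} (σ x y : Mat d) : ℂ :=
  (CFC.sqrt σ * xᴴ * CFC.sqrt σ * y).trace

/-- The KMS norm `‖x‖₂ = ⟨x, x⟩^{1/2}`. -/
def kmsNorm {d : ℕ} (σ x : Mat d) : ℝ := Real.sqrt (kmsInner σ x x).re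

/-- The map `x ↦ s x s`. -/
def sandwich {d : ℕ} (s : Mat d) : Mat d →ₗ[ℂ] Mat d where
  toFun x := s * x * s
  map_add' x y := by simp [mul_add, add_mul]
  map_smul' a x := by simp

/-- The KMS adjoint of a linear map which commutes with `x ↦ x^*` (in particular of a completely
positive map): `η^†(x) = σ^{-1/2} η^*(σ^{1/2} x σ^{1/2}) σ^{-1/2}`; see `kmsInner_kmsAdjoint`. -/
def kmsAdjoint {d : ℕ} (σ : Mat d) (η : Mat d →ₗ[ℂ] Mat d) : Mat d →ₗ[ℂ] Mat d :=
  sandwich (CFC.sqrt σ)⁻¹ ∘ₗ traceDual η ∘ₗ sandwich (CFC.sqrt σ)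

theorem kmsInner_kmsAdjoint {d : ℕ} {σ : Mat d} (hσ : σ.PosDef) {η : Mat d →ₗ[ℂ] Mat d}
    (hη : ∀ x, η xᴴ = (η x)ᴴ) (x y : Mat d) :
    kmsInner σ x (kmsAdjoint σ η y) = kmsInner σ (η x) y := by
  have hu : IsUnit (CFC.sqrt σ).det := by
    have h2 : CFC.sqrt σ * CFC.sqrt σ = σ := CFC.sqrt_mul_sqrt_self σ hσ.posSemidef.nonneg
    have h3 : IsUnit (CFC.sqrt σ * CFC.sqrt σ).det := by
      rw [h2]; exact (Matrix.isUnit_iff_isUnit_det σ).1 hσ.isUnit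
    rw [det_mul] at h3
    exact isUnit_of_mul_isUnit_left h3
  have e1 : kmsInner σ x (kmsAdjoint σ η y)
      = (xᴴ * traceDual η (CFC.sqrt σ * y * CFC.sqrt σ)).trace := by
    simp only [kmsInner, kmsAdjoint, sandwich, LinearMap.comp_apply, LinearMap.coe_mk,
      AddHom.coe_mk]
    rw [mul_assoc (CFC.sqrt σ * xᴴ), mul_assoc (CFC.sqrt σ)⁻¹, mul_nonsing_inv_cancel_left _ _ hu,
      mul_assoc (CFC.sqrt σ), trace_mul_comm, mul_assoc, mul_assoc, nonsing_inv_mul _ hu, mul_one]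
  rw [e1, trace_mul_comm, trace_traceDual_mul, hη, trace_mul_comm, kmsInner, ← mul_assoc,
    ← mul_assoc, trace_mul_comm]
  simp only [mul_assoc]

theorem kmsInner_krausMap {d : ℕ} {I : Type*} [Fintype I] (V : I → Mat d) {σ : Mat d}
    (hσ : σ.PosDef) (x y : Mat d) :
    kmsInner σ x (kmsAdjoint σ (krausMap V) y) = kmsInner σ (krausMap V x) y :=
  kmsInner_kmsAdjoint hσ (fun x => by simp [krausMap, conjTranspose_sum, mul_assoc]) x y

/-- The spectral gap `1 - max {|z| : z ∈ Sp(η), z ≠ 1}` of a map for which `1` is a simple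
eigenvalue and all the other eigenvalues lie in `[0, 1)`: the distance of `1` from the rest of the
spectrum. It is `1` if there is no other eigenvalue (dimension one). -/
def spectralGap {d : ℕ} (η : Mat d →ₗ[ℂ] Mat d) : ℝ :=
  1 - sSup {r : ℝ | ∃ z : ℂ, Module.End.HasEigenvalue η z ∧ z ≠ 1 ∧ r = ‖z‖}

/-- `π(g) = ∑ i, g(i) π(i)`, where `π(i) = tr (σ V_i^* V_i)`. -/
def statMean {d : ℕ} {I : Type*} [Fintype I] (V : I → Mat d) (σ : Mat d) (g : I → ℝ) : ℝ :=
  ∑ i, g i * (σ * (V i)ᴴ * V i).trace.re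

/-- The product `V_{i_n} ⋯ V_{i_1}`. -/
def krausWord {d : ℕ} {I : Type*} (V : I → Mat d) (i : ℕ → I) : ℕ → Mat d
  | 0 => 1
  | n + 1 => V (i (n + 1)) * krausWord V i n

/-- `X_1, X_2, …` is the output process with initial state `ρ`: its finite dimensional
distributions are `P(X_1 = i_1, …, X_n = i_n) = tr (V_{i_n} ⋯ V_{i_1} ρ V_{i_1}^* ⋯ V_{i_n}^*)`.
The value `X 0` plays no role. -/
def IsOutputProcess {d : ℕ} {I : Type*} [MeasurableSpace I] (V : I → Mat d) (ρ : Mat d)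
    {Ω : Type*} [MeasurableSpace Ω] (P : Measure Ω) (X : ℕ → Ω → I) : Prop :=
  (∀ k, 1 ≤ k → Measurable (X k)) ∧
    ∀ (n : ℕ) (i : ℕ → I), P.real {ω | ∀ k ∈ Finset.Icc 1 n, X k ω = i k} =
      (krausWord V i n * ρ * (krausWord V i n)ᴴ).trace.re

/-- `h(x) = (√(1 + x) + x / 2 + 1)⁻¹`. -/
def bernsteinH (x : ℝ) : ℝ := (Real.sqrt (1 + x) + x / 2 + 1)⁻¹

end QMC

end

/-!
# A Bernstein inequality for the output of a quantum Markov process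

With `a = σ^{1/4}`, replacing `x` by `a x a` turns the KMS inner product into the Hilbert–Schmidt
one and the Kraus operators `V i` into `K i = a⁻¹ V i a` (`symmKraus`). In this picture the channel
and its adjoint both fix the unit vector `ω = σ^{1/2}`, and the argument takes place in the real
Euclidean space `Herm d` of Hermitian matrices.

The exponential moment of `∑ f(X_k)` is `tr (ρ Φ_u^n(1))`, where `Φ_u` is the channel with its
`i`-th Kraus term weighted by `e^{u f(i)}` (`measureReal_sum_ge_le`). By the Cauchy–Schwarz
inequality it is at most `N_ρ ‖Φ_u‖^n`, so everything rests on bounding `‖Φ_u‖` by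
`exp (3 (u b)² / (ε - 10 u c))`; optimizing over `u` (`exists_tilt`) then gives the stated
exponent.

The bound on `‖Φ_u‖` (`norm_weightedKraus_exp_sq_le`) splits a vector into its component along `ω`
and the orthogonal rest `Z`, and needs no perturbation theory. Three estimates enter:

* `norm_weightedKraus_symm_sq_le`: on `Z` the channel contracts by `√(1 - ε)`. The real spectral
  theorem is applied to the representative of `Φ^† Φ`, whose eigenvalue `1` is simple by
  irreducibility (`eq_smul_of_fixed`).
* `norm_weightedKraus_le`: changing the weights by signed amounts of modulus at most `M` changes
  the map by at most `M` in norm, as the Jordan decomposition reduces signed weights and vectors to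
  positive ones.
* `norm_weightedKraus_fixed_sq_le`: applied to `ω`, the map with weights `g` has norm at most
  `π(g²)^{1/2}`, by the Kadison–Schwarz inequality and the comparison of the KMS and GNS norms. This
  brings in the variance `b²` instead of `c²`.

What remains is the positivity of a quadratic form in two variables (`tilt_discriminant_le`).
-/

noncomputable section

namespace QMC

/-! ### The Euclidean space of Hermitian matrices -/

/-- The real vector space of Hermitian `d × d` matrices. -/
def Herm (d : ℕ) : Type := selfAdjoint (Mat d)

namespace Herm

variable {d : ℕ}

instance : AddCommGroup (Herm d) := inferInstanceAs (AddCommGroup (selfAdjoint (Mat d)))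

instance : Module ℝ (Herm d) := inferInstanceAs (Module ℝ (selfAdjoint (Mat d)))

/-- The underlying matrix of an element of `Herm d`. -/
def mat (X : Herm d) : Mat d := X.1

/-- A Hermitian matrix as an element of `Herm d`. -/
def mk (x : Mat d) (hx : xᴴ = x) : Herm d := ⟨x, hx⟩

@[simp] theorem mat_mk (x : Mat d) (hx : xᴴ = x) : (mk x hx).mat = x := rfl

@[simp] theorem conjTranspose_mat (X : Herm d) : X.matᴴ = X.mat := X.2

@[ext] theorem ext {X Y : Herm d} (h : X.mat = Y.mat) : X = Y := Subtype.ext h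

theorem mat_zero : (0 : Herm d).mat = 0 := rfl
@[simp] theorem mat_add (X Y : Herm d) : (X + Y).mat = X.mat + Y.mat := rfl
@[simp] theorem mat_sub (X Y : Herm d) : (X - Y).mat = X.mat - Y.mat := rfl
@[simp] theorem mat_smul (r : ℝ) (X : Herm d) : (r • X).mat = r • X.mat := rfl

/-- The Hilbert–Schmidt inner product `re tr (X Y)` on Hermitian matrices. -/
instance innerProductCore : InnerProductSpace.Core ℝ (Herm d) where
  inner X Y := (X.mat * Y.mat).trace.re
  conj_inner_symm X Y := by
    show (Y.mat * X.mat).trace.re = _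
    rw [trace_mul_comm]
  re_inner_nonneg X := by
    show 0 ≤ (X.mat * X.mat).trace.re
    have h := (posSemidef_conjTranspose_mul_self X.mat).trace_nonneg
    rw [conjTranspose_mat] at h
    exact (Complex.le_def.1 h).1
  add_left X Y Z := by simp [add_mul]
  smul_left X Y r := by simp
  definite X h := by
    have h0 := (posSemidef_conjTranspose_mul_self X.mat).trace_nonneg
    rw [conjTranspose_mat] at h0
    have h1 : (X.mat * X.mat).trace = 0 := by
      rw [Complex.le_def] at h0
      exact Complex.ext h h0.2.symm
    rw [← conjTranspose_mat X] at h1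
    nth_rewrite 2 [conjTranspose_mat X] at h1
    exact ext (trace_conjTranspose_mul_self_eq_zero_iff.1 h1)

instance : NormedAddCommGroup (Herm d) := innerProductCore.toNormedAddCommGroup

instance : InnerProductSpace ℝ (Herm d) := InnerProductSpace.ofCore _

theorem inner_def (X Y : Herm d) : inner ℝ X Y = (X.mat * Y.mat).trace.re := rfl

theorem norm_sq_def (X : Herm d) : ‖X‖ ^ 2 = (X.mat * X.mat).trace.re := by
  rw [← real_inner_self_eq_norm_sq, inner_def]

instance : FiniteDimensional ℝ (Herm d) :=
  inferInstanceAs (FiniteDimensional ℝ (selfAdjoint.submodule ℝ (Mat d)))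

theorem inner_nonneg {X Y : Herm d} (hX : X.mat.PosSemidef) (hY : Y.mat.PosSemidef) :
    0 ≤ inner ℝ X Y := by
  -- with `X = s²`, the trace of `X Y` is the trace of the positive matrix `s Y s`
  have hs : (CFC.sqrt X.mat)ᴴ = CFC.sqrt X.mat :=
    (nonneg_iff_posSemidef.1 (CFC.sqrt_nonneg X.mat)).isHermitian
  have h : (CFC.sqrt X.mat * Y.mat * CFC.sqrt X.mat).PosSemidef := by
    have := hY.mul_mul_conjTranspose_same (CFC.sqrt X.mat)
    rwa [hs] at this
  have h0 := (Complex.le_def.1 h.trace_nonneg).1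
  rw [inner_def, ← CFC.sqrt_mul_sqrt_self X.mat hX.nonneg, mul_assoc, trace_mul_comm]
  exact h0

/-- The Jordan decomposition of a Hermitian matrix: as the two parts are orthogonal, `P + N`
(the absolute value) has the same Hilbert–Schmidt norm as `P - N`. -/
theorem exists_posPart_negPart (X : Herm d) : ∃ P N : Herm d,
    P.mat.PosSemidef ∧ N.mat.PosSemidef ∧ X = P - N ∧ ‖P + N‖ = ‖X‖ := by
  have hX : IsSelfAdjoint X.mat := X.2
  have hP : (X.mat⁺).PosSemidef := nonneg_iff_posSemidef.1 (CFC.posPart_nonneg _)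
  have hN : (X.mat⁻).PosSemidef := nonneg_iff_posSemidef.1 (CFC.negPart_nonneg _)
  have h1 : X = mk _ hP.isHermitian.eq - mk _ hN.isHermitian.eq := by
    ext1
    rw [mat_sub, mat_mk, mat_mk, CFC.posPart_sub_negPart X.mat hX]
  have h0 : inner ℝ (mk _ hP.isHermitian.eq) (mk _ hN.isHermitian.eq) = 0 := by
    rw [inner_def, mat_mk, mat_mk, CFC.posPart_mul_negPart, trace_zero, Complex.zero_re]
  refine ⟨mk _ hP.isHermitian.eq, mk _ hN.isHermitian.eq, hP, hN, h1, ?_⟩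
  have h2 := norm_add_sq_eq_norm_sq_add_norm_sq_real h0
  have h3 := norm_sub_sq_eq_norm_sq_add_norm_sq_real h0
  rw [← h1] at h3
  exact (sq_eq_sq₀ (norm_nonneg _) (norm_nonneg _)).1 (by nlinarith)

end Herm

/-! ### Kraus maps with signed weights -/

section WeightedKraus

variable {d : ℕ} {I : Type*} [Fintype I]

/-- The weighted Kraus map `X ↦ ∑ i, g i • K i ^* X K i` on Hermitian matrices; the real weights
`g` may have either sign. -/
def weightedKraus (K : I → Mat d) (g : I → ℝ) : Herm d →ₗ[ℝ] Herm d where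
  toFun X := Herm.mk (∑ i, g i • ((K i)ᴴ * X.mat * K i)) (by
    simp [conjTranspose_sum, mul_assoc])
  map_add' X Y := by
    ext1
    simp [mul_add, add_mul, Finset.sum_add_distrib]
  map_smul' r X := by
    ext1
    simp [Finset.smul_sum, smul_comm r]

theorem mat_weightedKraus (K : I → Mat d) (g : I → ℝ) (X : Herm d) :
    (weightedKraus K g X).mat = ∑ i, g i • ((K i)ᴴ * X.mat * K i) := rfl

theorem mat_weightedKraus_one (K : I → Mat d) (X : Herm d) :
    (weightedKraus K 1 X).mat = krausMap K X.mat := by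
  simp [mat_weightedKraus, krausMap]

theorem weightedKraus_add_weights (K : I → Mat d) (g h : I → ℝ) (X : Herm d) :
    weightedKraus K (g + h) X = weightedKraus K g X + weightedKraus K h X := by
  ext1
  simp [mat_weightedKraus, add_smul, Finset.sum_add_distrib]

/-- The Hilbert–Schmidt adjoint of a weighted Kraus map has the adjoint Kraus operators. -/
theorem inner_weightedKraus_left (K : I → Mat d) (g : I → ℝ) (X Y : Herm d) :
    inner ℝ (weightedKraus K g X) Y = inner ℝ X (weightedKraus (fun i => (K i)ᴴ) g Y) := by
  simp only [Herm.inner_def, mat_weightedKraus, Finset.sum_mul, Finset.mul_sum, trace_sum,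
    Complex.re_sum, smul_mul_assoc, mul_smul_comm, trace_smul, conjTranspose_conjTranspose]
  refine Finset.sum_congr rfl fun i _ => ?_
  congr 2
  rw [mul_assoc, mul_assoc, trace_mul_comm]
  simp only [mul_assoc]

/-- For Hermitian `X`, `Y` with Jordan decompositions `P - N` and `P' - N'`, bounded signed weights
are dominated by the weight `1` on the absolute values `P + N` and `P' + N'`. -/
theorem inner_weightedKraus_le_abs (K : I → Mat d) {g : I → ℝ} {M : ℝ} (hg : ∀ i, |g i| ≤ M)
    {P N P' N' : Herm d} (hP : P.mat.PosSemidef) (hN : N.mat.PosSemidef)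
    (hP' : P'.mat.PosSemidef) (hN' : N'.mat.PosSemidef) :
    inner ℝ (P' - N') (weightedKraus K g (P - N)) ≤
      M * inner ℝ (P' + N') (weightedKraus K 1 (P + N)) := by
  have key : ∀ i, ∀ A B : Herm d, A.mat.PosSemidef → B.mat.PosSemidef →
      0 ≤ (A.mat * ((K i)ᴴ * B.mat * K i)).trace.re := fun i A B hA hB => by
    have hB' := hB.conjTranspose_mul_mul_same (K i)
    exact Herm.inner_nonneg (X := A) (Y := Herm.mk _ hB'.isHermitian.eq) hA hB'
  simp only [Herm.inner_def, mat_weightedKraus, Finset.mul_sum, trace_sum, Complex.re_sum,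
    mul_smul_comm, trace_smul, Complex.smul_re, Pi.one_apply, one_smul]
  refine Finset.sum_le_sum fun i _ => ?_
  have h1 := key i P' P hP' hP
  have h2 := key i P' N hP' hN
  have h3 := key i N' P hN' hP
  have h4 := key i N' N hN' hN
  simp only [Herm.mat_sub, Herm.mat_add, sub_mul, mul_sub, add_mul, mul_add, trace_sub, trace_add,
    Complex.sub_re, Complex.add_re, smul_eq_mul]
  obtain ⟨h5, h6⟩ := abs_le.1 (hg i)
  nlinarith

/-- A contraction remains bounded by `M` when its Kraus terms are given signed weights of modulus
at most `M`. -/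
theorem norm_weightedKraus_le (K : I → Mat d) (hK : ∀ X, ‖weightedKraus K 1 X‖ ≤ ‖X‖)
    {g : I → ℝ} {M : ℝ} (hM : 0 ≤ M) (hg : ∀ i, |g i| ≤ M) (X : Herm d) :
    ‖weightedKraus K g X‖ ≤ M * ‖X‖ := by
  set Y := weightedKraus K g X with hY
  obtain ⟨P, N, hP, hN, hX, hXn⟩ := X.exists_posPart_negPart
  obtain ⟨P', N', hP', hN', hY', hYn⟩ := Y.exists_posPart_negPart
  have h1 : ‖Y‖ ^ 2 ≤ M * (‖Y‖ * ‖X‖) := by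
    calc ‖Y‖ ^ 2 = inner ℝ (P' - N') (weightedKraus K g (P - N)) := by
          rw [← hX, ← hY', ← hY, real_inner_self_eq_norm_sq]
      _ ≤ M * inner ℝ (P' + N') (weightedKraus K 1 (P + N)) :=
          inner_weightedKraus_le_abs K hg hP hN hP' hN'
      _ ≤ M * (‖P' + N'‖ * ‖weightedKraus K 1 (P + N)‖) :=
          mul_le_mul_of_nonneg_left (real_inner_le_norm _ _) hM
      _ ≤ M * (‖Y‖ * ‖X‖) := by
          rw [hYn, ← hXn]
          gcongr
          exact hK _
  rcases (norm_nonneg Y).eq_or_lt with h0 | h0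
  · rw [← h0]
    positivity
  · nlinarith

theorem trace_conjTranspose_mul_self_re_nonneg (x : Mat d) : 0 ≤ (xᴴ * x).trace.re :=
  (Complex.le_def.1 (posSemidef_conjTranspose_mul_self x).trace_nonneg).1

/-- The variance-type bound for `∑ i, g i V i ^* V i`: its KMS norm is at most its GNS norm,
because the commutator of `a²` with it has nonnegative Hilbert–Schmidt norm, and the GNS norm is
controlled by the Kadison–Schwarz inequality. -/
theorem trace_weighted_sq_le {V : I → Mat d} (hV : ∑ i, (V i)ᴴ * V i = 1) {a : Mat d}
    (ha : aᴴ = a) (g : I → ℝ) :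
    (a * a * (∑ i, g i • ((V i)ᴴ * V i)) * (a * a) * (∑ i, g i • ((V i)ᴴ * V i))).trace.re ≤
      ∑ i, g i ^ 2 * (a * a * (a * a) * ((V i)ᴴ * V i)).trace.re := by
  set x := ∑ i, g i • ((V i)ᴴ * V i) with hx
  have hxh : xᴴ = x := by simp [hx, conjTranspose_sum]
  -- Kadison–Schwarz, with the defect written as a sum of squares
  have hKS : ∑ i, (g i • V i - V i * x)ᴴ * (g i • V i - V i * x) =
      ∑ i, g i ^ 2 • ((V i)ᴴ * V i) - x * x := by
    have h : ∀ i, (g i • V i - V i * x)ᴴ * (g i • V i - V i * x) =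
        g i ^ 2 • ((V i)ᴴ * V i) - (g i • ((V i)ᴴ * V i)) * x - x * (g i • ((V i)ᴴ * V i))
          + x * ((V i)ᴴ * V i) * x := fun i => by
      simp only [conjTranspose_sub, conjTranspose_smul, conjTranspose_mul, hxh, star_trivial,
        sub_mul, mul_sub, smul_mul_assoc, mul_smul_comm, smul_sub, smul_smul, mul_assoc, pow_two]
      abel
    simp only [h, Finset.sum_add_distrib, Finset.sum_sub_distrib, ← Finset.sum_mul,
      ← Finset.mul_sum, hV, ← hx]
    noncomm_ring
  have h1 : 0 ≤ (a * a * (∑ i, g i ^ 2 • ((V i)ᴴ * V i) - x * x) * (a * a)).trace.re := by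
    rw [← hKS, Finset.mul_sum, Finset.sum_mul, trace_sum, Complex.re_sum]
    refine Finset.sum_nonneg fun i _ => ?_
    have := trace_conjTranspose_mul_self_re_nonneg ((g i • V i - V i * x) * (a * a))
    simpa only [conjTranspose_mul, ha, mul_assoc] using this
  have h2 := trace_conjTranspose_mul_self_re_nonneg (a * a * x - x * (a * a))
  have e1 : (x * (a * a) * (a * a) * x).trace = (a * a * (x * x) * (a * a)).trace := by
    rw [trace_mul_comm (a * a * (x * x)), mul_assoc, mul_assoc, trace_mul_comm]
    simp only [mul_assoc]
  have e2 : (x * (a * a) * x * (a * a)).trace = (a * a * x * (a * a) * x).trace := by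
    rw [trace_mul_comm (x * (a * a) * x)]
    simp only [mul_assoc]
  have e3 : ((a * a * x - x * (a * a))ᴴ * (a * a * x - x * (a * a))).trace =
      2 * (a * a * (x * x) * (a * a)).trace - 2 * (a * a * x * (a * a) * x).trace := by
    have : (a * a * x - x * (a * a))ᴴ * (a * a * x - x * (a * a)) =
        x * (a * a) * (a * a) * x - x * (a * a) * x * (a * a) - a * a * x * (a * a) * x
          + a * a * (x * x) * (a * a) := by
      simp only [conjTranspose_sub, conjTranspose_mul, ha, hxh]
      noncomm_ring
    rw [this, trace_add, trace_sub, trace_sub, e1, e2]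
    ring
  rw [e3] at h2
  have e4 : (a * a * (∑ i, g i ^ 2 • ((V i)ᴴ * V i)) * (a * a)).trace.re =
      ∑ i, g i ^ 2 * (a * a * (a * a) * ((V i)ᴴ * V i)).trace.re := by
    rw [Finset.mul_sum, Finset.sum_mul, trace_sum, Complex.re_sum]
    refine Finset.sum_congr rfl fun i _ => ?_
    rw [mul_smul_comm, smul_mul_assoc, trace_smul, Complex.smul_re, trace_mul_comm, smul_eq_mul]
    simp only [mul_assoc]
  rw [mul_sub, sub_mul, trace_sub, Complex.sub_re, e4] at h1
  simp at h2
  simp only [mul_assoc] at h1 h2 ⊢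
  linarith

/-- The bound of `trace_weighted_sq_le` in the symmetric picture, with `ω = a²` a fixed point of
the Kraus map. -/
theorem norm_weightedKraus_fixed_sq_le {K : I → Mat d} {a : Mat d} (ha : aᴴ = a)
    (hu : IsUnit a.det) {ω : Herm d} (hω : ω.mat = a * a) (hK : weightedKraus K 1 ω = ω)
    (g : I → ℝ) :
    ‖weightedKraus K g ω‖ ^ 2 ≤ ∑ i, g i ^ 2 * (ω.mat * ((K i)ᴴ * ω.mat * K i)).trace.re := by
  have hai : (a⁻¹)ᴴ = a⁻¹ := by rw [conjTranspose_nonsing_inv, ha]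
  have h1 : a * a⁻¹ = 1 := mul_nonsing_inv a hu
  have h2 : a⁻¹ * a = 1 := nonsing_inv_mul a hu
  have hVV : ∀ i, (a * K i * a⁻¹)ᴴ * (a * K i * a⁻¹) = a⁻¹ * ((K i)ᴴ * ω.mat * K i) * a⁻¹ := by
    intro i
    simp only [conjTranspose_mul, ha, hai, hω, mul_assoc]
  have hV : ∑ i, (a * K i * a⁻¹)ᴴ * (a * K i * a⁻¹) = 1 := by
    have := congrArg Herm.mat hK
    rw [mat_weightedKraus] at this
    simp only [Pi.one_apply, one_smul] at this
    simp only [hVV]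
    rw [← Finset.sum_mul, ← Finset.mul_sum, this, hω]
    rw [← mul_assoc, h2, one_mul, h1]
  have h := trace_weighted_sq_le hV ha g
  have hx : ∑ i, g i • ((a * K i * a⁻¹)ᴴ * (a * K i * a⁻¹)) =
      a⁻¹ * (weightedKraus K g ω).mat * a⁻¹ := by
    simp only [hVV, mat_weightedKraus, Finset.mul_sum, Finset.sum_mul, mul_smul_comm,
      smul_mul_assoc]
  rw [hx] at h
  set Y := (weightedKraus K g ω).mat with hY
  have e1 : (a * a * (a⁻¹ * Y * a⁻¹) * (a * a) * (a⁻¹ * Y * a⁻¹)).trace = (Y * Y).trace := by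
    have : a * a * (a⁻¹ * Y * a⁻¹) * (a * a) * (a⁻¹ * Y * a⁻¹) =
        a * ((a * a⁻¹) * Y * (a⁻¹ * a) * (a * a⁻¹) * Y * a⁻¹) := by simp only [mul_assoc]
    rw [this, h1, h2, trace_mul_comm, mul_assoc _ a⁻¹ a, h2]
    simp
  have e2 : ∀ i, (a * a * (a * a) * ((a * K i * a⁻¹)ᴴ * (a * K i * a⁻¹))).trace =
      (ω.mat * ((K i)ᴴ * ω.mat * K i)).trace := by
    intro i
    rw [hVV]
    have : a * a * (a * a) * (a⁻¹ * ((K i)ᴴ * ω.mat * K i) * a⁻¹) =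
        a * (a * a * (a * a⁻¹) * ((K i)ᴴ * ω.mat * K i) * a⁻¹) := by simp only [mul_assoc]
    rw [this, h1, trace_mul_comm, mul_assoc _ a⁻¹ a, h2, hω]
    simp
  simp only [e1, e2] at h
  rw [Herm.norm_sq_def]
  exact h

end WeightedKraus

/-! ### The norm of the tilted channel -/

section Tilt

variable {d : ℕ} {I : Type*} [Fintype I]

/-- The discriminant condition behind `norm_weightedKraus_exp_sq_le`. After dividing by
`1 + (s + κ t)`, where `κ = 1 + t`, it is a polynomial inequality in `1 - s` and `t`. -/
theorem tilt_discriminant_le {s t : ℝ} (hs0 : 0 ≤ s) (ht0 : 0 ≤ t)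
    (ht : 10 * t < 1 - s ^ 2) :
    0 ≤ 1 - (s + (1 + t) * t) ^ 2 ∧
    ((1 + t) * (1 + (s + (1 + t) * t))) ^ 2 ≤
      (6 / (1 - s ^ 2 - 10 * t) - 4) * (1 - (s + (1 + t) * t) ^ 2) := by
  have hs1 : s ≤ 1 := by nlinarith
  obtain ⟨η, hη⟩ : ∃ η, s = 1 - η := ⟨1 - s, by ring⟩
  have hη0 : 0 ≤ η := by linarith
  have hη1 : η ≤ 1 := by linarith
  subst hη
  have hte : 10 * t ≤ η * (2 - η) := by nlinarith
  have ht1 : t ≤ 1 / 10 := by nlinarith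
  have htη : t ≤ η / 5 := by nlinarith
  have hκ : (1 + t) * t ≤ 11 / 10 * t := by nlinarith
  have hκ0 : 0 ≤ (1 + t) * t := by positivity
  have hD : 0 < 1 - (1 - η) ^ 2 - 10 * t := by linarith
  have hκ2 : (1 + t) ^ 2 ≤ 1 + 21 / 10 * t := by nlinarith
  have hq : 0 ≤ 1 - (1 - η) - (1 + t) * t := by nlinarith
  have hmain : (1 + t) ^ 2 * (1 + (1 - η + (1 + t) * t)) * (1 - (1 - η) ^ 2 - 10 * t) ≤
      (6 - 4 * (1 - (1 - η) ^ 2 - 10 * t)) * (1 - (1 - η + (1 + t) * t)) := by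
    have h1 : (1 + t) ^ 2 * (1 + (1 - η + (1 + t) * t)) ≤ (2 - η) + 28 / 5 * t := by
      calc (1 + t) ^ 2 * (1 + (1 - η + (1 + t) * t))
          ≤ (1 + 21 / 10 * t) * (2 - η + 11 / 10 * t) :=
            mul_le_mul hκ2 (by linarith) (by linarith) (by linarith)
        _ ≤ (2 - η) + 28 / 5 * t := by nlinarith [mul_nonneg ht0 hη0]
    calc (1 + t) ^ 2 * (1 + (1 - η + (1 + t) * t)) * (1 - (1 - η) ^ 2 - 10 * t)
        ≤ ((2 - η) + 28 / 5 * t) * (1 - (1 - η) ^ 2 - 10 * t) :=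
          mul_le_mul_of_nonneg_right h1 hD.le
      _ ≤ (6 - 4 * (1 - (1 - η) ^ 2 - 10 * t)) * (η - 11 / 10 * t) := by
          have e : 0 ≤ η * (2 - 4 * η + 3 * η ^ 2) :=
            mul_nonneg hη0 (by nlinarith [sq_nonneg (3 * η - 2)])
          have e2 : 0 ≤ t * (13 + 20 * η) := by positivity
          nlinarith [mul_nonneg ht0 hη0, mul_nonneg (mul_nonneg ht0 hη0) hη0, sq_nonneg t]
      _ ≤ _ := mul_le_mul_of_nonneg_left (by linarith) (by nlinarith)
  have hE : (6 / (1 - (1 - η) ^ 2 - 10 * t) - 4) =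
      (6 - 4 * (1 - (1 - η) ^ 2 - 10 * t)) / (1 - (1 - η) ^ 2 - 10 * t) := by
    field_simp
  constructor
  · nlinarith
  · rw [hE, div_mul_eq_mul_div, le_div_iff₀ hD]
    have hp : 0 ≤ 1 + (1 - η + (1 + t) * t) := by linarith
    nlinarith [mul_le_mul_of_nonneg_right hmain hp]

theorem two_mul_mul_le_of_sq_le {x z E F G : ℝ} (hE : 0 ≤ E) (hF : 0 ≤ F) (hG : G ^ 2 ≤ E * F)
    (hx : 0 ≤ x) (hz : 0 ≤ z) : 2 * (x * G * z) ≤ x ^ 2 * E + F * z ^ 2 := by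
  have hG' : G ≤ √E * √F := by
    rw [← Real.sqrt_mul hE]
    exact Real.le_sqrt_of_sq_le hG
  have h1 : x * G * z ≤ x * (√E * √F) * z := by gcongr
  have h2 := sq_nonneg (x * √E - √F * z)
  have h3 : (x * √E - √F * z) ^ 2 =
      x ^ 2 * √E ^ 2 + √F ^ 2 * z ^ 2 - 2 * (x * (√E * √F) * z) := by ring
  rw [h3, Real.sq_sqrt hE, Real.sq_sqrt hF] at h2
  linarith

/-- The one-step estimate for the tilted channel `∑ i, e^{u f(i)} K i ^* · K i`. The vector `X` is
split into its component along the fixed vector `ω` and the rest `Z`. The diagonal terms are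
controlled by the exponential moment of `f` and by the spectral gap `1 - s²`; the off-diagonal one
is of first order in `u`, as the tilt has to act once to couple `ω` with `Z`. -/
theorem norm_weightedKraus_exp_sq_le {K : I → Mat d} {ω : Herm d} (hω : ‖ω‖ = 1)
    (hK : weightedKraus K 1 ω = ω) (hK' : weightedKraus (fun i => (K i)ᴴ) 1 ω = ω)
    {p : I → ℝ} (hp : ∀ i, 0 ≤ p i) (hp1 : ∑ i, p i = 1)
    (hA : ∀ g : I → ℝ, ‖weightedKraus K g ω‖ ^ 2 ≤ ∑ i, g i ^ 2 * p i)
    (hA' : ∀ g : I → ℝ, ‖weightedKraus (fun i => (K i)ᴴ) g ω‖ ^ 2 ≤ ∑ i, g i ^ 2 * p i)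
    {s : ℝ} (hs0 : 0 ≤ s)
    (hgap : ∀ Z : Herm d, inner ℝ ω Z = 0 → ‖weightedKraus K 1 Z‖ ≤ s * ‖Z‖)
    (hcontr : ∀ Z : Herm d, ‖weightedKraus K 1 Z‖ ≤ ‖Z‖)
    {f : I → ℝ} {b c u : ℝ} (hb : 0 ≤ b) (hf : ∑ i, f i * p i = 0)
    (hfb : ∑ i, f i ^ 2 * p i = b ^ 2) (hfc : ∀ i, |f i| ≤ c) (hc : 0 ≤ c) (hu : 0 ≤ u)
    (huc : 10 * (u * c) < 1 - s ^ 2) (X : Herm d) :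
    ‖weightedKraus K (fun i => Real.exp (u * f i)) X‖ ^ 2 ≤
      (1 + 6 * (u * b) ^ 2 / (1 - s ^ 2 - 10 * (u * c))) * ‖X‖ ^ 2 := by
  set t := u * c with ht
  have ht0 : 0 ≤ t := by positivity
  have ht1 : t ≤ 1 / 10 := by nlinarith [sq_nonneg s]
  have huf : ∀ i, |u * f i| ≤ t := fun i => by
    rw [abs_mul, abs_of_nonneg hu]
    exact mul_le_mul_of_nonneg_left (hfc i) hu
  set g : I → ℝ := fun i => Real.exp (u * f i) - 1 with hg
  have hgκ : ∀ i, |g i| ≤ (1 + t) * |u * f i| := fun i => by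
    have h1 := Real.abs_exp_sub_one_sub_id_le (x := u * f i) (by linarith [huf i])
    have h2 : |g i| ≤ |Real.exp (u * f i) - 1 - u * f i| + |u * f i| := by
      have := abs_add_le (Real.exp (u * f i) - 1 - u * f i) (u * f i)
      simpa [hg] using this
    have h3 : (u * f i) ^ 2 = |u * f i| * |u * f i| := by rw [← pow_two, sq_abs]
    nlinarith [huf i, abs_nonneg (u * f i)]
  have hgM : ∀ i, |g i| ≤ (1 + t) * t := fun i =>
    (hgκ i).trans (mul_le_mul_of_nonneg_left (huf i) (by linarith))
  have hg2 : ∑ i, g i ^ 2 * p i ≤ ((1 + t) * (u * b)) ^ 2 := by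
    calc ∑ i, g i ^ 2 * p i ≤ ∑ i, ((1 + t) * u) ^ 2 * (f i ^ 2 * p i) := by
          refine Finset.sum_le_sum fun i _ => ?_
          have : g i ^ 2 ≤ ((1 + t) * |u * f i|) ^ 2 := by
            rw [← sq_abs (g i)]
            exact pow_le_pow_left₀ (abs_nonneg _) (hgκ i) 2
          rw [mul_pow, sq_abs] at this
          nlinarith [hp i]
      _ = ((1 + t) * (u * b)) ^ 2 := by
          rw [← Finset.mul_sum, hfb]
          ring
  have hgω : ‖weightedKraus K g ω‖ ≤ (1 + t) * (u * b) :=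
    abs_le_of_sq_le_sq' ((hA g).trans hg2) (by positivity) |>.2
  have hgω' : ‖weightedKraus (fun i => (K i)ᴴ) g ω‖ ≤ (1 + t) * (u * b) :=
    abs_le_of_sq_le_sq' ((hA' g).trans hg2) (by positivity) |>.2
  have hexp : (fun i => Real.exp (u * f i)) = 1 + g := by
    ext i
    simp [hg]
  set T := weightedKraus K (fun i => Real.exp (u * f i)) with hT
  have hTX : ∀ X, T X = weightedKraus K 1 X + weightedKraus K g X := fun X => by
    rw [hT, hexp, weightedKraus_add_weights]
  -- the second exponential moment of `f`
  have hTω : ‖T ω‖ ^ 2 ≤ 1 + 4 * (u * b) ^ 2 := by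
    refine (hA _).trans ?_
    calc ∑ i, Real.exp (u * f i) ^ 2 * p i
        ≤ ∑ i, (p i + 2 * u * (f i * p i) + 4 * u ^ 2 * (f i ^ 2 * p i)) := by
          refine Finset.sum_le_sum fun i _ => ?_
          have h1 := Real.abs_exp_sub_one_sub_id_le (x := 2 * (u * f i)) (by
            rw [abs_mul, abs_two]
            linarith [huf i])
          have h2 := (abs_le.1 h1).2
          have h3 : Real.exp (u * f i) ^ 2 = Real.exp (2 * (u * f i)) := by
            rw [← Real.exp_nat_mul]
            norm_num
          rw [h3]
          nlinarith [hp i]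
      _ = 1 + 4 * (u * b) ^ 2 := by
          rw [Finset.sum_add_distrib, Finset.sum_add_distrib, ← Finset.mul_sum, ← Finset.mul_sum,
            hp1, hf, hfb]
          ring
  set m : ℝ := inner ℝ ω X with hm
  set Z := X - m • ω with hZ
  have hωω : inner ℝ ω ω = 1 := by rw [real_inner_self_eq_norm_sq, hω, one_pow]
  have hωZ : inner ℝ ω Z = 0 := by
    rw [hZ, inner_sub_right, real_inner_smul_right, hωω, ← hm]
    ring
  have hX : X = m • ω + Z := by simp [hZ]
  have hXn : ‖X‖ ^ 2 = m ^ 2 + ‖Z‖ ^ 2 := by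
    rw [hX, norm_add_sq_real, real_inner_smul_left, hωZ, norm_smul, hω, mul_one, mul_zero,
      mul_zero, add_zero, Real.norm_eq_abs, sq_abs]
  have hTZ : ‖T Z‖ ≤ (s + (1 + t) * t) * ‖Z‖ := by
    rw [hTX]
    refine (norm_add_le _ _).trans ?_
    rw [add_mul]
    exact add_le_add (hgap Z hωZ) (norm_weightedKraus_le K hcontr (by positivity) hgM Z)
  have hcross : |inner ℝ (T ω) (T Z)| ≤
      (u * b) * ((1 + t) * (1 + (s + (1 + t) * t))) * ‖Z‖ := by
    have e : inner ℝ (T ω) (T Z) = inner ℝ (weightedKraus (fun i => (K i)ᴴ) g ω) Z +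
        inner ℝ (weightedKraus K g ω) (T Z) := by
      have e1 : inner ℝ ω (weightedKraus K 1 Z) = 0 := by
        rw [real_inner_comm, inner_weightedKraus_left, hK', real_inner_comm, hωZ]
      have e2 : inner ℝ ω (weightedKraus K g Z) =
          inner ℝ (weightedKraus (fun i => (K i)ᴴ) g ω) Z := by
        rw [real_inner_comm, inner_weightedKraus_left, real_inner_comm]
      rw [hTX ω, hK, inner_add_left]
      nth_rewrite 1 [hTX Z]
      rw [inner_add_right, e1, e2, zero_add]
    rw [e]
    calc _ ≤ |inner ℝ (weightedKraus (fun i => (K i)ᴴ) g ω) Z| +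
            |inner ℝ (weightedKraus K g ω) (T Z)| := abs_add_le _ _
      _ ≤ ((1 + t) * (u * b)) * ‖Z‖ + ((1 + t) * (u * b)) * ((s + (1 + t) * t) * ‖Z‖) := by
          refine add_le_add ((abs_real_inner_le_norm _ _).trans ?_)
            ((abs_real_inner_le_norm _ _).trans ?_)
          · exact mul_le_mul_of_nonneg_right hgω' (norm_nonneg _)
          · exact mul_le_mul hgω hTZ (norm_nonneg _) (by positivity)
      _ = _ := by ring
  have hsq : ‖T X‖ ^ 2 = m ^ 2 * ‖T ω‖ ^ 2 + 2 * (m * inner ℝ (T ω) (T Z)) + ‖T Z‖ ^ 2 := by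
    rw [hX, map_add, map_smul, norm_add_sq_real, real_inner_smul_left, norm_smul, mul_pow,
      Real.norm_eq_abs, sq_abs]
  obtain ⟨hF, hG⟩ := tilt_discriminant_le hs0 ht0 huc
  set D := 1 - s ^ 2 - 10 * t with hD
  set C := s + (1 + t) * t with hC
  set G := (1 + t) * (1 + C) with hGdef
  have hD0 : 0 < D := by linarith
  have hE : 0 ≤ 6 / D - 4 := by
    rw [sub_nonneg, le_div_iff₀ hD0]
    linarith [sq_nonneg s]
  have hTZ2 : ‖T Z‖ ^ 2 ≤ C ^ 2 * ‖Z‖ ^ 2 := by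
    rw [← mul_pow]
    exact pow_le_pow_left₀ (norm_nonneg _) hTZ 2
  have hmc : 2 * (m * inner ℝ (T ω) (T Z)) ≤ 2 * (|m| * (u * b) * G * ‖Z‖) := by
    refine mul_le_mul_of_nonneg_left ((le_abs_self _).trans ?_) zero_le_two
    rw [abs_mul, mul_assoc |m|, mul_assoc |m|]
    exact mul_le_mul_of_nonneg_left hcross (abs_nonneg _)
  have hamgm := two_mul_mul_le_of_sq_le hE hF hG (x := |m| * (u * b)) (z := ‖Z‖)
    (by positivity) (norm_nonneg Z)
  rw [mul_pow, sq_abs] at hamgm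
  have hδ : 0 ≤ 6 * (u * b) ^ 2 / D := by positivity
  have hm2 : m ^ 2 * ‖T ω‖ ^ 2 ≤ m ^ 2 * (1 + 4 * (u * b) ^ 2) :=
    mul_le_mul_of_nonneg_left hTω (sq_nonneg m)
  have hfin : (1 + 6 * (u * b) ^ 2 / D) * (m ^ 2 + ‖Z‖ ^ 2) =
      m ^ 2 * (1 + 4 * (u * b) ^ 2) + m ^ 2 * (u * b) ^ 2 * (6 / D - 4) + ‖Z‖ ^ 2 +
      6 * (u * b) ^ 2 / D * ‖Z‖ ^ 2 := by ring
  rw [hsq, hXn, hfin]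
  linarith [mul_nonneg hδ (sq_nonneg ‖Z‖)]

end Tilt

/-! ### The symmetric picture and the spectral gap -/

section Gap

/-- A symmetric operator whose eigenvectors either have eigenvalue at most `q` or are multiples of
`ω` is bounded by `q` in the quadratic form sense on the orthogonal complement of `ω`. -/
theorem inner_apply_le_of_eigenvalues {E : Type*} [NormedAddCommGroup E] [InnerProductSpace ℝ E]
    [FiniteDimensional ℝ E] {T : E →ₗ[ℝ] E} (hT : T.IsSymmetric) {q : ℝ} {ω : E}
    (h : ∀ (μ : ℝ) (v : E), v ≠ 0 → T v = μ • v → μ ≤ q ∨ ∃ r : ℝ, v = r • ω)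
    {z : E} (hz : inner ℝ ω z = 0) : inner ℝ z (T z) ≤ q * ‖z‖ ^ 2 := by
  set e := hT.eigenvectorBasis rfl with he
  have h1 : inner ℝ z (T z) = ∑ i, hT.eigenvalues rfl i * (inner ℝ (e i) z) ^ 2 := by
    rw [← e.sum_inner_mul_inner z (T z)]
    refine Finset.sum_congr rfl fun i _ => ?_
    rw [← hT (e i) z, he, hT.apply_eigenvectorBasis rfl i, real_inner_smul_left,
      real_inner_comm z]
    simp only [RCLike.ofReal_real_eq_id, id]
    ring
  have h2 : ‖z‖ ^ 2 = ∑ i, (inner ℝ (e i) z) ^ 2 := by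
    rw [← e.sum_sq_norm_inner_right z]
    simp
  rw [h1, h2, Finset.mul_sum]
  refine Finset.sum_le_sum fun i _ => ?_
  rcases h (hT.eigenvalues rfl i) (e i) (e.orthonormal.ne_zero i)
    (hT.apply_eigenvectorBasis rfl i) with h3 | ⟨r, hr⟩
  · exact mul_le_mul_of_nonneg_right h3 (sq_nonneg _)
  · rw [hr, real_inner_smul_left, hz]
    simp

variable {d : ℕ} {I : Type*} [Fintype I]

theorem trace_mul_krausMap (K : I → Mat d) (x y : Mat d) :
    (x * krausMap K y).trace = (krausMap (fun i => (K i)ᴴ) x * y).trace := by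
  simp only [krausMap, LinearMap.coe_mk, AddHom.coe_mk, Finset.mul_sum, Finset.sum_mul, trace_sum,
    conjTranspose_conjTranspose]
  refine Finset.sum_congr rfl fun i _ => ?_
  rw [← mul_assoc, ← mul_assoc, trace_mul_comm]
  simp only [mul_assoc]

theorem traceDual_krausMap (V : I → Mat d) (x : Mat d) :
    traceDual (krausMap V) x = krausMap (fun i => (V i)ᴴ) x := by
  refine ext_iff_trace_mul_right.2 fun y => ?_
  rw [trace_traceDual_mul, trace_mul_krausMap]

/-- The Kraus operators `a⁻¹ V i a`. With `a = σ^{1/4}` they represent the channel in the symmetric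
picture, where `x` is replaced by `a x a` and the KMS inner product becomes the Hilbert–Schmidt
one. -/
def symmKraus (a : Mat d) (V : I → Mat d) (i : I) : Mat d := a⁻¹ * V i * a

theorem conjTranspose_symmKraus {J : Type*} {a : Mat d} (ha : aᴴ = a) (V : J → Mat d) (i : J) :
    (symmKraus a V i)ᴴ = a * (V i)ᴴ * a⁻¹ := by
  simp only [symmKraus, conjTranspose_mul, conjTranspose_nonsing_inv, ha, mul_assoc]

theorem krausMap_symmKraus {a : Mat d} (ha : aᴴ = a) (hu : IsUnit a.det) (V : I → Mat d)
    (x : Mat d) : krausMap (symmKraus a V) (a * x * a) = a * krausMap V x * a := by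
  simp only [krausMap, LinearMap.coe_mk, AddHom.coe_mk, Finset.mul_sum, Finset.sum_mul,
    conjTranspose_symmKraus ha]
  simp only [symmKraus, mul_assoc, nonsing_inv_mul_cancel_left _ _ hu,
    mul_nonsing_inv_cancel_left _ _ hu]

theorem krausMap_conjTranspose_symmKraus {a : Mat d} (ha : aᴴ = a) (hu : IsUnit a.det)
    (V : I → Mat d) (x : Mat d) :
    krausMap (fun i => (symmKraus a V i)ᴴ) (a⁻¹ * x * a⁻¹) =
      a⁻¹ * krausMap (fun i => (V i)ᴴ) x * a⁻¹ := by
  simp only [krausMap, LinearMap.coe_mk, AddHom.coe_mk, Finset.mul_sum, Finset.sum_mul,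
    conjTranspose_conjTranspose]
  simp only [conjTranspose_symmKraus ha]
  simp only [symmKraus, mul_assoc, nonsing_inv_mul_cancel_left _ _ hu,
    mul_nonsing_inv_cancel_left _ _ hu]

/-- In the symmetric picture `Φ^† Φ` becomes the product of the Kraus map with its Hilbert–Schmidt
adjoint. -/
theorem mul_kmsAdjoint_comp_mul {a : Mat d} (ha : aᴴ = a) (hu : IsUnit a.det) {σ : Mat d}
    (hs : CFC.sqrt σ = a * a) (V : I → Mat d) (x : Mat d) :
    a * (kmsAdjoint σ (krausMap V) ∘ₗ krausMap V) x * a =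
      krausMap (fun i => (symmKraus a V i)ᴴ) (krausMap (symmKraus a V) (a * x * a)) := by
  have h := krausMap_conjTranspose_symmKraus ha hu V (a * a * krausMap V x * (a * a))
  have e : a⁻¹ * (a * a * krausMap V x * (a * a)) * a⁻¹ = a * krausMap V x * a := by
    simp only [mul_assoc, nonsing_inv_mul_cancel_left _ _ hu, mul_nonsing_inv _ hu, mul_one]
  rw [e] at h
  rw [krausMap_symmKraus ha hu, h]
  simp only [LinearMap.comp_apply, kmsAdjoint, sandwich, LinearMap.coe_mk, AddHom.coe_mk, hs,
    traceDual_krausMap, Matrix.mul_inv_rev]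
  simp only [mul_assoc, nonsing_inv_mul _ hu, mul_nonsing_inv_cancel_left _ _ hu, mul_one]

theorem traceDual_kmsAdjoint_comp_of_fixed {a : Mat d} (ha : aᴴ = a) (hu : IsUnit a.det)
    {σ : Mat d} (hs : CFC.sqrt σ = a * a) (V : I → Mat d) {R : Mat d}
    (hR : krausMap (fun i => (symmKraus a V i)ᴴ) (krausMap (symmKraus a V) R) = R) :
    traceDual (kmsAdjoint σ (krausMap V) ∘ₗ krausMap V) (a * R * a) = a * R * a := by
  refine ext_iff_trace_mul_right.2 fun y => ?_
  rw [trace_traceDual_mul, mul_assoc, mul_assoc, trace_mul_comm, mul_assoc,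
    mul_kmsAdjoint_comp_mul ha hu hs, trace_mul_krausMap]
  simp only [conjTranspose_conjTranspose]
  rw [trace_mul_krausMap, hR, ← mul_assoc, ← mul_assoc, trace_mul_comm]
  simp only [mul_assoc]

open scoped Matrix.Norms.L2Operator in
theorem exists_nonneg_add_algebraMap {x : Mat d} (hx : xᴴ = x) :
    ∃ r : ℝ, 0 ≤ x + algebraMap ℝ (Mat d) r := by
  have h := IsSelfAdjoint.neg_algebraMap_norm_le_self (a := x) hx
  exact ⟨‖x‖, by rwa [← neg_le_iff_add_nonneg]⟩

/-- Irreducibility of `Φ^† Φ` makes the eigenvalue `1` simple: a Hermitian fixed point, shifted by a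
large multiple of the identity, yields an invariant state of the dual. -/
theorem eq_smul_of_fixed {a : Mat d} (ha : aᴴ = a) (hu : IsUnit a.det) {σ : Mat d}
    (hσ : IsState σ) (hs : CFC.sqrt σ = a * a) {V : I → Mat d}
    (hΨ : IsIrreducible (kmsAdjoint σ (krausMap V) ∘ₗ krausMap V)) {ω : Herm d}
    (hω : ω.mat = a * a)
    (hωfix : krausMap (fun i => (symmKraus a V i)ᴴ) (krausMap (symmKraus a V) ω.mat) = ω.mat)
    {X : Herm d}
    (hX : krausMap (fun i => (symmKraus a V i)ᴴ) (krausMap (symmKraus a V) X.mat) = X.mat) :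
    ∃ r : ℝ, X = r • ω := by
  obtain ⟨σ', -, -, -, huniq⟩ := hΨ
  have hai : (a⁻¹)ᴴ = a⁻¹ := by rw [conjTranspose_nonsing_inv, ha]
  have hσa : σ = a * ω.mat * a := by
    rw [hω, ← CFC.sqrt_mul_sqrt_self σ hσ.1.nonneg, hs]
    simp only [mul_assoc]
  have hσ' : σ = σ' := huniq σ hσ (by
    have := traceDual_kmsAdjoint_comp_of_fixed ha hu hs V hωfix
    rwa [← hσa] at this)
  obtain ⟨r, hr⟩ := exists_nonneg_add_algebraMap (x := a⁻¹ * X.mat * a⁻¹) (by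
    simp only [conjTranspose_mul, hai, Herm.conjTranspose_mat, mul_assoc])
  have hr' := nonneg_iff_posSemidef.1 hr
  set R : Mat d := X.mat + (r + 1 : ℝ) • ω.mat with hRdef
  have hR : krausMap (fun i => (symmKraus a V i)ᴴ) (krausMap (symmKraus a V) R) = R := by
    rw [hRdef, map_add, map_add, hX, ← Complex.coe_smul, map_smul, map_smul, hωfix]
  have hτ : a * R * a = a * a * (a⁻¹ * X.mat * a⁻¹ + algebraMap ℝ (Mat d) r) * (a * a) + σ := by
    have e : a * a * (a⁻¹ * X.mat * a⁻¹) * (a * a) = a * X.mat * a := by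
      simp only [mul_assoc, nonsing_inv_mul_cancel_left _ _ hu, mul_nonsing_inv_cancel_left _ _ hu]
    rw [mul_add (a * a), add_mul _ _ (a * a), e, hRdef, hσa, Algebra.algebraMap_eq_smul_one, hω]
    simp only [mul_add, add_mul, add_smul, one_smul, mul_smul_comm, smul_mul_assoc, mul_one,
      mul_assoc, add_assoc]
  have hpsd : (a * a * (a⁻¹ * X.mat * a⁻¹ + algebraMap ℝ (Mat d) r) * (a * a)).PosSemidef := by
    have h := hr'.conjTranspose_mul_mul_same (a * a)
    rwa [conjTranspose_mul, ha] at h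
  have hτpsd : (a * R * a).PosSemidef := hτ ▸ hpsd.add hσ.1
  obtain ⟨k, hk1, hk⟩ : ∃ k : ℝ, 1 ≤ k ∧ (a * R * a).trace = k := by
    have h0 := Complex.le_def.1 hpsd.trace_nonneg
    refine ⟨(a * R * a).trace.re, ?_, ?_⟩
    · rw [hτ, trace_add, hσ.2]
      simpa using h0.1
    · rw [hτ, trace_add, hσ.2]
      refine Complex.ext (by simp) ?_
      simpa using h0.2.symm
  have hk0 : k ≠ 0 := by linarith
  have hkC : (k : ℂ) ≠ 0 := by exact_mod_cast hk0
  have hst : IsState ((k : ℂ)⁻¹ • (a * R * a)) := by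
    refine ⟨hτpsd.smul ?_, ?_⟩
    · rw [← Complex.ofReal_inv]
      exact_mod_cast inv_nonneg.2 (by linarith)
    · rw [trace_smul, hk, smul_eq_mul, inv_mul_cancel₀ hkC]
  have heq : (k : ℂ)⁻¹ • (a * R * a) = a * ω.mat * a := by
    rw [huniq _ hst (by rw [map_smul, traceDual_kmsAdjoint_comp_of_fixed ha hu hs V hR]), ← hσ',
      hσa]
  have heq2 : a * R * a = a * ((k : ℂ) • ω.mat) * a := by
    rw [mul_smul_comm, smul_mul_assoc, ← heq, smul_smul, mul_inv_cancel₀ hkC, one_smul]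
  have heq3 : R = (k : ℂ) • ω.mat := by
    have h := congrArg (fun y => a⁻¹ * y * a⁻¹) heq2
    simpa only [mul_assoc, nonsing_inv_mul_cancel_left _ _ hu, mul_nonsing_inv _ hu, mul_one]
      using h
  refine ⟨k - (r + 1), Herm.ext ?_⟩
  rw [Herm.mat_smul, sub_smul, ← Complex.coe_smul k, ← heq3, hRdef, add_sub_cancel_right]

/-- The spectral gap as an operator inequality in the symmetric picture: a Hermitian eigenvector is
an eigenvector of `Φ^† Φ`, so its eigenvalue is at most `1 - ε` unless it is `1`, in which case the
eigenvector is a multiple of `ω`. -/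
theorem norm_weightedKraus_symm_sq_le {a : Mat d} (ha : aᴴ = a) (hu : IsUnit a.det) {σ : Mat d}
    (hσ : IsState σ) (hs : CFC.sqrt σ = a * a) {V : I → Mat d}
    (hΨ : IsIrreducible (kmsAdjoint σ (krausMap V) ∘ₗ krausMap V)) {ω : Herm d}
    (hω : ω.mat = a * a) (hK : weightedKraus (symmKraus a V) 1 ω = ω)
    (hK' : weightedKraus (fun i => (symmKraus a V i)ᴴ) 1 ω = ω) {Z : Herm d}
    (hZ : inner ℝ ω Z = 0) :
    ‖weightedKraus (symmKraus a V) 1 Z‖ ^ 2 ≤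
      (1 - spectralGap (kmsAdjoint σ (krausMap V) ∘ₗ krausMap V)) * ‖Z‖ ^ 2 := by
  set K := symmKraus a V with hKdef
  set T := weightedKraus (fun i => (K i)ᴴ) 1 ∘ₗ weightedKraus K 1 with hT
  have hTinner : ∀ X Y, inner ℝ X (T Y) = inner ℝ (weightedKraus K 1 X) (weightedKraus K 1 Y) :=
    fun X Y => by rw [inner_weightedKraus_left, hT, LinearMap.comp_apply]
  have hTmat : ∀ X, (T X).mat = krausMap (fun i => (K i)ᴴ) (krausMap K X.mat) := fun X => by
    rw [hT, LinearMap.comp_apply, mat_weightedKraus_one, mat_weightedKraus_one]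
  have hsymm : T.IsSymmetric := fun X Y => by
    rw [hTinner, real_inner_comm, hTinner, real_inner_comm]
  have hωfix : krausMap (fun i => (K i)ᴴ) (krausMap K ω.mat) = ω.mat := by
    rw [← hTmat, hT, LinearMap.comp_apply, hK, hK']
  rw [← real_inner_self_eq_norm_sq, ← hTinner]
  refine inner_apply_le_of_eigenvalues hsymm (fun μ X hX0 hX => ?_) hZ
  have hXmat : krausMap (fun i => (K i)ᴴ) (krausMap K X.mat) = μ • X.mat := by
    rw [← hTmat, hX, Herm.mat_smul]
  by_cases hμ : μ = 1
  · right
    exact eq_smul_of_fixed ha hu hσ hs hΨ hω hωfix (by rw [hXmat, hμ, one_smul])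
  · left
    -- conjugating back gives an eigenvector of `Φ^† Φ`
    have hev : Module.End.HasEigenvalue (kmsAdjoint σ (krausMap V) ∘ₗ krausMap V) (μ : ℂ) := by
      refine Module.End.hasEigenvalue_of_hasEigenvector (x := a⁻¹ * X.mat * a⁻¹)
        ⟨Module.End.mem_eigenspace_iff.2 ?_, fun h0 => hX0 (Herm.ext ?_)⟩
      · have h := mul_kmsAdjoint_comp_mul ha hu hs V (a⁻¹ * X.mat * a⁻¹)
        have e : a * (a⁻¹ * X.mat * a⁻¹) * a = X.mat := by
          simp only [mul_assoc, mul_nonsing_inv_cancel_left _ _ hu, nonsing_inv_mul _ hu, mul_one]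
        rw [e, ← hKdef, hXmat] at h
        have h' := congrArg (fun y => a⁻¹ * y * a⁻¹) h
        simpa only [mul_assoc, nonsing_inv_mul_cancel_left _ _ hu, mul_nonsing_inv _ hu, mul_one,
          mul_smul_comm, smul_mul_assoc, Complex.coe_smul] using h'
      · have h' := congrArg (fun y => a * y * a) h0
        simpa only [mul_assoc, mul_nonsing_inv_cancel_left _ _ hu, nonsing_inv_mul _ hu, mul_one,
          mul_zero, zero_mul, Herm.mat_zero] using h'
    have hfin : {r : ℝ | ∃ z : ℂ, Module.End.HasEigenvalue
        (kmsAdjoint σ (krausMap V) ∘ₗ krausMap V) z ∧ z ≠ 1 ∧ r = ‖z‖}.Finite := by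
      refine ((Module.End.finite_hasEigenvalue
        (kmsAdjoint σ (krausMap V) ∘ₗ krausMap V)).image (fun z => ‖z‖)).subset ?_
      rintro r ⟨z, hz, -, rfl⟩
      exact ⟨z, hz, rfl⟩
    have hle := le_csSup hfin.bddAbove ⟨(μ : ℂ), hev, by exact_mod_cast hμ, rfl⟩
    rw [spectralGap, sub_sub_cancel]
    refine le_trans ?_ hle
    rw [Complex.norm_real]
    exact le_abs_self μ

theorem norm_le_of_norm_le_on_orthogonal {K : I → Mat d} {ω : Herm d} (hω : ‖ω‖ = 1)
    (hK : weightedKraus K 1 ω = ω) (hK' : weightedKraus (fun i => (K i)ᴴ) 1 ω = ω) {s : ℝ}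
    (hs : s ≤ 1) (h : ∀ Z, inner ℝ ω Z = 0 → ‖weightedKraus K 1 Z‖ ≤ s * ‖Z‖) (X : Herm d) :
    ‖weightedKraus K 1 X‖ ≤ ‖X‖ := by
  set m : ℝ := inner ℝ ω X with hm
  set Z := X - m • ω with hZ
  have hωZ : inner ℝ ω Z = 0 := by
    rw [hZ, inner_sub_right, real_inner_smul_right, real_inner_self_eq_norm_sq, hω, ← hm]
    ring
  have hωTZ : inner ℝ ω (weightedKraus K 1 Z) = 0 := by
    rw [real_inner_comm, inner_weightedKraus_left, hK', real_inner_comm, hωZ]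
  have hX : X = m • ω + Z := by simp [hZ]
  have hZ1 : ‖weightedKraus K 1 Z‖ ≤ ‖Z‖ :=
    (h Z hωZ).trans (mul_le_of_le_one_left (norm_nonneg _) hs)
  refine (sq_le_sq₀ (norm_nonneg _) (norm_nonneg _)).1 ?_
  rw [hX, map_add, map_smul, hK, norm_add_sq_real, norm_add_sq_real, real_inner_smul_left,
    real_inner_smul_left, hωZ, hωTZ]
  have := pow_le_pow_left₀ (norm_nonneg _) hZ1 2
  linarith

theorem spectralGap_le_one (η : Mat d →ₗ[ℂ] Mat d) : spectralGap η ≤ 1 := by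
  rw [spectralGap, sub_le_self_iff]
  refine Real.sSup_nonneg ?_
  rintro r ⟨z, -, -, rfl⟩
  exact norm_nonneg z

theorem iterate_weightedKraus_symmKraus {a : Mat d} (ha : aᴴ = a) (hu : IsUnit a.det)
    (V : I → Mat d) (g : I → ℝ) {X Y : Herm d} (h : Y.mat = a * X.mat * a) (n : ℕ) :
    ((weightedKraus (symmKraus a V) g)^[n] Y).mat = a * ((weightedKraus V g)^[n] X).mat * a := by
  induction n generalizing X Y with
  | zero => exact h
  | succ n ih =>
    rw [Function.iterate_succ_apply, Function.iterate_succ_apply]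
    refine ih ?_
    simp only [mat_weightedKraus, h, conjTranspose_symmKraus ha, Finset.mul_sum, Finset.sum_mul]
    simp only [symmKraus, mul_assoc, nonsing_inv_mul_cancel_left _ _ hu,
      mul_nonsing_inv_cancel_left _ _ hu, mul_smul_comm, smul_mul_assoc]

/-- The KMS norm is the Hilbert–Schmidt norm in the symmetric picture. -/
theorem kmsNorm_eq_norm {a : Mat d} (hu : IsUnit a.det) {σ ρ : Mat d} (hs : CFC.sqrt σ = a * a)
    (hs' : (CFC.sqrt σ)ᴴ = CFC.sqrt σ) (hρ : ρᴴ = ρ) {R : Herm d} (hR : R.mat = a⁻¹ * ρ * a⁻¹) :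
    kmsNorm σ ((CFC.sqrt σ)⁻¹ * ρ * (CFC.sqrt σ)⁻¹) = ‖R‖ := by
  have e : kmsInner σ ((CFC.sqrt σ)⁻¹ * ρ * (CFC.sqrt σ)⁻¹)
      ((CFC.sqrt σ)⁻¹ * ρ * (CFC.sqrt σ)⁻¹) = (R.mat * R.mat).trace := by
    have hy : ((CFC.sqrt σ)⁻¹ * ρ * (CFC.sqrt σ)⁻¹)ᴴ = (CFC.sqrt σ)⁻¹ * ρ * (CFC.sqrt σ)⁻¹ := by
      rw [conjTranspose_mul, conjTranspose_mul, conjTranspose_nonsing_inv, hs', hρ, mul_assoc]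
    rw [kmsInner, hy, hs, Matrix.mul_inv_rev, hR]
    have : a * a * (a⁻¹ * a⁻¹ * ρ * (a⁻¹ * a⁻¹)) * (a * a) * (a⁻¹ * a⁻¹ * ρ * (a⁻¹ * a⁻¹)) =
        (ρ * a⁻¹ * a⁻¹ * ρ * a⁻¹) * a⁻¹ := by
      simp only [mul_assoc, nonsing_inv_mul_cancel_left _ _ hu, mul_nonsing_inv_cancel_left _ _ hu]
    rw [this, trace_mul_comm]
    simp only [mul_assoc]
  rw [kmsNorm, e, ← Herm.norm_sq_def, Real.sqrt_sq (norm_nonneg _)]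

end Gap

/-! ### Words and the exponential moment -/

section Words

variable {d : ℕ} {I : Type*}

theorem krausWord_congr (V : I → Mat d) {i j : ℕ → I} :
    ∀ {n : ℕ}, (∀ k ∈ Finset.Icc 1 n, i k = j k) → krausWord V i n = krausWord V j n
  | 0, _ => rfl
  | n + 1, h => by
    rw [krausWord, krausWord, h (n + 1) (by simp),
      krausWord_congr V fun k hk => h k (Finset.Icc_subset_Icc_right n.le_succ hk)]

/-- The sequence `ℕ → I` whose entries `1, …, n` spell the word `w`; all other entries are
irrelevant and set to `i₀`. -/
def extendWord (i₀ : I) {n : ℕ} (w : Fin n → I) (k : ℕ) : I :=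
  if h : k - 1 < n then w ⟨k - 1, h⟩ else i₀

theorem extendWord_snoc_last (i₀ : I) {n : ℕ} (w : Fin n → I) (j : I) :
    extendWord i₀ (Fin.snoc w j : Fin (n + 1) → I) (n + 1) = j := by
  simp [extendWord, Fin.snoc]

theorem extendWord_snoc (i₀ : I) {n : ℕ} (w : Fin n → I) (j : I) {k : ℕ}
    (hk : k ∈ Finset.Icc 1 n) :
    extendWord i₀ (Fin.snoc w j : Fin (n + 1) → I) k = extendWord i₀ w k := by
  rw [Finset.mem_Icc] at hk
  have h1 : k - 1 < n := by omega
  have h2 : k - 1 < n + 1 := by omega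
  simp [extendWord, Fin.snoc, h1, h2]

variable [Fintype I]

/-- Expansion of an iterated weighted Kraus map over words; the newest letter of the word acts
first. -/
theorem sum_words_eq_iterate (V : I → Mat d) (g : I → ℝ) (i₀ : I) (n : ℕ) (X : Herm d) :
    ∑ w : Fin n → I, (∏ k ∈ Finset.Icc 1 n, g (extendWord i₀ w k)) •
      ((krausWord V (extendWord i₀ w) n)ᴴ * X.mat * krausWord V (extendWord i₀ w) n) =
    ((weightedKraus V g)^[n] X).mat := by
  induction n generalizing X with
  | zero => simp [krausWord]
  | succ n ih =>
    rw [Function.iterate_succ_apply, ← ih, ← (Fin.snocEquiv fun _ => I).sum_comp,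
      Fintype.sum_prod_type_right]
    refine Finset.sum_congr rfl fun w _ => ?_
    rw [mat_weightedKraus, Finset.mul_sum, Finset.sum_mul, Finset.smul_sum]
    refine Finset.sum_congr rfl fun j _ => ?_
    have e1 : krausWord V (extendWord i₀ (Fin.snoc w j : Fin (n + 1) → I)) n =
        krausWord V (extendWord i₀ w) n :=
      krausWord_congr V fun k hk => extendWord_snoc i₀ w j hk
    have e2 : ∏ k ∈ Finset.Icc 1 n, g (extendWord i₀ (Fin.snoc w j : Fin (n + 1) → I) k) =
        ∏ k ∈ Finset.Icc 1 n, g (extendWord i₀ w k) :=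
      Finset.prod_congr rfl fun k hk => by rw [extendWord_snoc i₀ w j hk]
    show (∏ k ∈ Finset.Icc 1 (n + 1), g (extendWord i₀ (Fin.snoc w j : Fin (n + 1) → I) k)) •
      ((krausWord V (extendWord i₀ (Fin.snoc w j : Fin (n + 1) → I)) (n + 1))ᴴ * X.mat *
        krausWord V (extendWord i₀ (Fin.snoc w j : Fin (n + 1) → I)) (n + 1)) = _
    rw [Finset.prod_Icc_succ_top (by omega), krausWord, extendWord_snoc_last, e1, e2]
    simp only [conjTranspose_mul, mul_smul_comm, smul_mul_assoc, smul_smul, mul_assoc]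

/-- Chernoff bound for the output process: the exponential moment of the sum is given by the
iterated tilted channel applied to the identity. -/
theorem measureReal_sum_ge_le [MeasurableSpace I] (V : I → Mat d) (ρ : Mat d) {Ω : Type*}
    [MeasurableSpace Ω] (P : Measure Ω) [IsProbabilityMeasure P] {X : ℕ → Ω → I}
    (hX : IsOutputProcess V ρ P X) (f : I → ℝ) {u : ℝ} (hu : 0 ≤ u) (γ : ℝ) {n : ℕ} (hn : 1 ≤ n)
    {E : Herm d} (hE : E.mat = 1) :
    P.real {ω | γ ≤ (1 / (n : ℝ)) * ∑ k ∈ Finset.Icc 1 n, f (X k ω)} ≤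
      Real.exp (-(n * (u * γ))) *
        (ρ * ((weightedKraus V fun i => Real.exp (u * f i))^[n] E).mat).trace.re := by
  classical
  have hn0 : (0 : ℝ) < n := by exact_mod_cast hn
  obtain ⟨ω₀⟩ := P.nonempty_of_neZero
  set i₀ := X 0 ω₀
  set A : (Fin n → I) → Set Ω :=
    fun w => {ω | ∀ k ∈ Finset.Icc 1 n, X k ω = extendWord i₀ w k} with hA
  set S : (Fin n → I) → ℝ := fun w => ∑ k ∈ Finset.Icc 1 n, f (extendWord i₀ w k) with hS
  set good : Finset (Fin n → I) := Finset.univ.filter fun w => n * γ ≤ S w with hgood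
  have hsub : {ω | γ ≤ (1 / (n : ℝ)) * ∑ k ∈ Finset.Icc 1 n, f (X k ω)} ⊆
      ⋃ w ∈ good, A w := by
    intro ω hω
    have hw : ∀ k ∈ Finset.Icc 1 n,
        X k ω = extendWord i₀ (fun l : Fin n => X (l + 1) ω) k := by
      intro k hk
      rw [Finset.mem_Icc] at hk
      have h1 : k - 1 < n := by omega
      have h2 : k - 1 + 1 = k := by omega
      simp [extendWord, h1, h2]
    refine Set.mem_biUnion (x := fun l : Fin n => X (l + 1) ω) ?_ hw
    simp only [hgood, Finset.coe_filter, Finset.mem_univ, true_and, Set.mem_ofPred_eq, hS]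
    rw [← Finset.sum_congr rfl fun k hk => congrArg f (hw k hk)]
    have h3 : γ ≤ (1 / (n : ℝ)) * ∑ k ∈ Finset.Icc 1 n, f (X k ω) := hω
    rwa [one_div, le_inv_mul_iff₀ hn0] at h3
  calc P.real {ω | γ ≤ (1 / (n : ℝ)) * ∑ k ∈ Finset.Icc 1 n, f (X k ω)}
      ≤ P.real (⋃ w ∈ good, A w) := measureReal_mono hsub (measure_ne_top _ _)
    _ ≤ ∑ w ∈ good, P.real (A w) := measureReal_biUnion_finset_le _ _
    _ ≤ ∑ w ∈ good, Real.exp (-(n * (u * γ))) * (Real.exp (u * S w) * P.real (A w)) := by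
        refine Finset.sum_le_sum fun w hw => ?_
        rw [← mul_assoc, ← Real.exp_add]
        refine le_mul_of_one_le_left measureReal_nonneg (Real.one_le_exp ?_)
        have := mul_le_mul_of_nonneg_left (Finset.mem_filter.1 hw).2 hu
        linarith
    _ ≤ ∑ w, Real.exp (-(n * (u * γ))) * (Real.exp (u * S w) * P.real (A w)) :=
        Finset.sum_le_sum_of_subset_of_nonneg (Finset.subset_univ _) fun w _ _ => by positivity
    _ = _ := by
        rw [← Finset.mul_sum]
        congr 1
        rw [← sum_words_eq_iterate V _ i₀ n E, Finset.mul_sum, trace_sum, Complex.re_sum]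
        refine Finset.sum_congr rfl fun w _ => ?_
        rw [hA, hX.2 n (extendWord i₀ w), ← Real.exp_sum, ← Finset.mul_sum, mul_smul_comm,
          trace_smul, Complex.smul_re, smul_eq_mul, hE, mul_one, trace_mul_comm, ← mul_assoc,
          trace_mul_comm ρ]

end Words

/-! ### Iteration and the choice of the tilt -/

theorem norm_iterate_le {E : Type*} [SeminormedAddCommGroup E] {T : E → E} {r : ℝ}
    (hr : 0 ≤ r) (h : ∀ x, ‖T x‖ ≤ r * ‖x‖) (n : ℕ) (x : E) : ‖T^[n] x‖ ≤ r ^ n * ‖x‖ := by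
  induction n with
  | zero => simp
  | succ n ih =>
    rw [Function.iterate_succ_apply', pow_succ', mul_assoc]
    exact (h _).trans (mul_le_mul_of_nonneg_left ih hr)

/-- The Legendre transform of `u ↦ 3 (u b)² / (ε - 10 u c)`. The optimal `u` is
`ε / (10 c) * (1 - 1 / w)` with `w = √(1 + 10 c γ / (3 b²))`. -/
theorem exists_tilt {b c γ ε : ℝ} (hb : 0 < b) (hc : 0 < c) (hγ : 0 < γ) (hε : 0 < ε) :
    ∃ u : ℝ, 0 ≤ u ∧ 10 * (u * c) < ε ∧
      3 * (u * b) ^ 2 / (ε - 10 * (u * c)) - u * γ =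
        -(γ ^ 2 * ε / (6 * b ^ 2) * bernsteinH (10 * c * γ / (3 * b ^ 2))) := by
  have hx0 : 0 < 10 * c * γ / (3 * b ^ 2) := by positivity
  set x := 10 * c * γ / (3 * b ^ 2) with hx
  set w := √(1 + x) with hw
  have hw2 : w ^ 2 = 1 + x := Real.sq_sqrt (by positivity)
  have hw0 : 0 < w := Real.sqrt_pos.2 (by positivity)
  have hw1 : 1 < w := by nlinarith
  have hγx : γ = 3 * b ^ 2 * (w ^ 2 - 1) / (10 * c) := by
    rw [hw2, hx]
    field_simp
    ring
  have hden : ε - 10 * (ε / (10 * c) * (1 - 1 / w) * c) = ε / w := by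
    field_simp
    ring
  refine ⟨ε / (10 * c) * (1 - 1 / w), ?_, ?_, ?_⟩
  · have : 1 / w ≤ 1 := by
      rw [div_le_one hw0]
      exact hw1.le
    exact mul_nonneg (by positivity) (by linarith)
  · have : 0 < ε / w := by positivity
    linarith
  · have hh : bernsteinH x = 2 / (w + 1) ^ 2 := by
      rw [bernsteinH, ← hw, show w + x / 2 + 1 = (w + 1) ^ 2 / 2 by linarith, inv_div]
    have hw3 : w + 1 ≠ 0 := by positivity
    rw [hden, hh, hγx]
    field_simp
    ring

theorem bernsteinH_nonneg {x : ℝ} (hx : 0 ≤ x) : 0 ≤ bernsteinH x := by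
  unfold bernsteinH
  positivity

end QMC

end

/-! ### The concentration inequality -/

theorem theorem3p1 {d : ℕ} {I : Type*} [Fintype I] [MeasurableSpace I] [MeasurableSingletonClass I]
    (V : I → QMC.Mat d) (hV : ∑ i, (V i)ᴴ * V i = 1)
    (σ : QMC.Mat d) (hσ : QMC.IsUniqueFaithfulInvariantState (QMC.krausMap V) σ)
    (hΨ : QMC.IsIrreducible (QMC.kmsAdjoint σ (QMC.krausMap V) ∘ₗ QMC.krausMap V))
    (f : I → ℝ) (b c : ℝ) (hb : 0 < b) (hc : 0 < c)
    (hf : QMC.statMean V σ f = 0)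
    (hfb : QMC.statMean V σ (fun i => f i ^ 2) = b ^ 2)
    (hfc : ‖f‖ = c)
    (ρ : QMC.Mat d) (hρ : QMC.IsState ρ)
    {Ω : Type*} [MeasurableSpace Ω] (P : Measure Ω) [IsProbabilityMeasure P]
    (X : ℕ → Ω → I) (hX : QMC.IsOutputProcess V ρ P X)
    (γ : ℝ) (hγ : 0 < γ) (n : ℕ) (hn : 1 ≤ n) :
    P.real {ω | γ ≤ (1 / (n : ℝ)) * ∑ k ∈ Finset.Icc 1 n, f (X k ω)} ≤
      QMC.kmsNorm σ ((CFC.sqrt σ)⁻¹ * ρ * (CFC.sqrt σ)⁻¹) *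
        Real.exp (-((n : ℝ) * (γ ^ 2 *
          QMC.spectralGap (QMC.kmsAdjoint σ (QMC.krausMap V) ∘ₗ QMC.krausMap V) / (6 * b ^ 2)) *
          QMC.bernsteinH (10 * c * γ / (3 * b ^ 2)))) := by
  classical
  have hσps := hσ.1.1
  have hss : CFC.sqrt σ * CFC.sqrt σ = σ := CFC.sqrt_mul_sqrt_self σ hσps.nonneg
  have hsps : (CFC.sqrt σ).PosSemidef := nonneg_iff_posSemidef.1 (CFC.sqrt_nonneg σ)
  obtain ⟨a, hadef⟩ : ∃ a, a = CFC.sqrt (CFC.sqrt σ) := ⟨_, rfl⟩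
  have hs : CFC.sqrt σ = a * a := by
    rw [hadef, CFC.sqrt_mul_sqrt_self (CFC.sqrt σ) hsps.nonneg]
  have ha : aᴴ = a := by
    rw [hadef]
    exact (nonneg_iff_posSemidef.1 (CFC.sqrt_nonneg (CFC.sqrt σ))).isHermitian.eq
  have hσa : σ = a * a * (a * a) := by rw [← hs, hss]
  have hu : IsUnit a.det := by
    have h : IsUnit σ.det := (Matrix.isUnit_iff_isUnit_det σ).1 hσ.2.1.isUnit
    rw [hσa, det_mul, det_mul] at h
    exact isUnit_of_mul_isUnit_left (isUnit_of_mul_isUnit_left h)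
  set K := QMC.symmKraus a V with hKdef
  have haa : (a * a)ᴴ = a * a := by rw [conjTranspose_mul, ha]
  obtain ⟨ω, hω⟩ : ∃ ω : QMC.Herm d, ω.mat = a * a := ⟨QMC.Herm.mk _ haa, rfl⟩
  obtain ⟨E, hE⟩ : ∃ E : QMC.Herm d, E.mat = 1 := ⟨QMC.Herm.mk 1 conjTranspose_one, rfl⟩
  have hρh : ρᴴ = ρ := hρ.1.isHermitian.eq
  obtain ⟨R, hR⟩ : ∃ R : QMC.Herm d, R.mat = a⁻¹ * ρ * a⁻¹ :=
    ⟨QMC.Herm.mk (a⁻¹ * ρ * a⁻¹) (by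
      rw [conjTranspose_mul, conjTranspose_mul, conjTranspose_nonsing_inv, ha, hρh, mul_assoc]),
      rfl⟩
  have hωn : ‖ω‖ = 1 := by
    have h : ‖ω‖ ^ 2 = 1 := by
      rw [QMC.Herm.norm_sq_def, hω, ← hσa, hσ.1.2, Complex.one_re]
    exact (pow_eq_one_iff_of_nonneg (norm_nonneg _) two_ne_zero).1 h
  have hK : QMC.weightedKraus K 1 ω = ω := by
    ext1
    have h1 : QMC.krausMap V 1 = 1 := by simpa [QMC.krausMap] using hV
    have h2 := QMC.krausMap_symmKraus ha hu V 1
    rw [h1, mul_one] at h2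
    rw [QMC.mat_weightedKraus_one, hω, h2]
  have hK' : QMC.weightedKraus (fun i => (K i)ᴴ) 1 ω = ω := by
    ext1
    have h1 : QMC.krausMap (fun i => (V i)ᴴ) σ = σ := by
      rw [← QMC.traceDual_krausMap, hσ.2.2.1]
    have h2 := QMC.krausMap_conjTranspose_symmKraus ha hu V σ
    have h3 : a⁻¹ * σ * a⁻¹ = a * a := by
      rw [hσa]
      simp only [mul_assoc, nonsing_inv_mul_cancel_left _ _ hu, mul_nonsing_inv _ hu, mul_one]
    rw [h1, h3] at h2
    rw [QMC.mat_weightedKraus_one, hω, h2]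
  have hp : ∀ i, (ω.mat * ((K i)ᴴ * ω.mat * K i)).trace.re = (σ * (V i)ᴴ * V i).trace.re := by
    intro i
    rw [hKdef, QMC.conjTranspose_symmKraus ha, QMC.symmKraus, hω, hσa]
    have : a * a * (a * (V i)ᴴ * a⁻¹ * (a * a) * (a⁻¹ * V i * a)) =
        (a * a * a * (V i)ᴴ * V i) * a := by
      simp only [mul_assoc, nonsing_inv_mul_cancel_left _ _ hu, mul_nonsing_inv_cancel_left _ _ hu]
    rw [this, trace_mul_comm]
    simp only [mul_assoc]
  have hp0 : ∀ i, 0 ≤ (σ * (V i)ᴴ * V i).trace.re := by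
    intro i
    have h := (hσps.mul_mul_conjTranspose_same (V i)).trace_nonneg
    rw [trace_mul_cycle, trace_mul_comm, ← mul_assoc] at h
    exact (Complex.le_def.1 h).1
  have hp1 : ∑ i, (σ * (V i)ᴴ * V i).trace.re = 1 := by
    simp only [mul_assoc]
    rw [← Complex.re_sum, ← trace_sum, ← Finset.mul_sum, hV, mul_one, hσ.1.2, Complex.one_re]
  have hA : ∀ g : I → ℝ, ‖QMC.weightedKraus K g ω‖ ^ 2 ≤
      ∑ i, g i ^ 2 * (σ * (V i)ᴴ * V i).trace.re := fun g => by
    simpa only [hp] using QMC.norm_weightedKraus_fixed_sq_le ha hu hω hK g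
  have hA' : ∀ g : I → ℝ, ‖QMC.weightedKraus (fun i => (K i)ᴴ) g ω‖ ^ 2 ≤
      ∑ i, g i ^ 2 * (σ * (V i)ᴴ * V i).trace.re := fun g => by
    have h := QMC.norm_weightedKraus_fixed_sq_le ha hu hω hK' g
    have e : ∀ i, (ω.mat * (((K i)ᴴ)ᴴ * ω.mat * (K i)ᴴ)).trace.re =
        (σ * (V i)ᴴ * V i).trace.re := fun i => by
      rw [← hp, conjTranspose_conjTranspose, mul_assoc, ← mul_assoc, trace_mul_comm]
      simp only [mul_assoc]
    simpa only [e] using h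
  have hN := QMC.kmsNorm_eq_norm hu hs hsps.isHermitian.eq hρh hR
  rw [hN]
  have hN1 : 1 ≤ ‖R‖ := by
    have h1 : inner ℝ ω R = 1 := by
      have : a * a * (a⁻¹ * ρ * a⁻¹) = (a * ρ) * a⁻¹ := by
        simp only [mul_assoc, mul_nonsing_inv_cancel_left _ _ hu]
      rw [QMC.Herm.inner_def, hω, hR, this, trace_mul_comm, nonsing_inv_mul_cancel_left _ _ hu,
        hρ.2, Complex.one_re]
    have h2 := real_inner_le_norm ω R
    rwa [h1, hωn, one_mul] at h2
  set ε := QMC.spectralGap (QMC.kmsAdjoint σ (QMC.krausMap V) ∘ₗ QMC.krausMap V) with hεdef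
  have hh : 0 ≤ QMC.bernsteinH (10 * c * γ / (3 * b ^ 2)) := QMC.bernsteinH_nonneg (by positivity)
  rcases le_or_gt ε 0 with hε | hε
  · -- for `ε ≤ 0` the bound is trivial: `1 ≤ N_ρ` and the exponential is at least `1`
    have h1 : 0 ≤ -((n : ℝ) * (γ ^ 2 * ε / (6 * b ^ 2)) *
        QMC.bernsteinH (10 * c * γ / (3 * b ^ 2))) := by
      rw [neg_nonneg]
      refine mul_nonpos_of_nonpos_of_nonneg (mul_nonpos_of_nonneg_of_nonpos (by positivity) ?_) hh
      exact div_nonpos_of_nonpos_of_nonneg (mul_nonpos_of_nonneg_of_nonpos (by positivity) hε)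
        (by positivity)
    exact measureReal_le_one.trans (one_le_mul_of_one_le_of_one_le hN1 (Real.one_le_exp h1))
  have hε1 : ε ≤ 1 := QMC.spectralGap_le_one _
  have hs2 : √(1 - ε) ^ 2 = 1 - ε := Real.sq_sqrt (by linarith)
  have hgap : ∀ Z : QMC.Herm d, inner ℝ ω Z = 0 →
      ‖QMC.weightedKraus K 1 Z‖ ≤ √(1 - ε) * ‖Z‖ := fun Z hZ => by
    refine (sq_le_sq₀ (norm_nonneg _) (by positivity)).1 ?_
    rw [mul_pow, hs2]
    exact QMC.norm_weightedKraus_symm_sq_le ha hu hσ.1 hs hΨ hω hK hK' hZ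
  have hcontr : ∀ Z : QMC.Herm d, ‖QMC.weightedKraus K 1 Z‖ ≤ ‖Z‖ :=
    QMC.norm_le_of_norm_le_on_orthogonal hωn hK hK' (Real.sqrt_le_one.2 (by linarith)) hgap
  obtain ⟨u, hu0, huc, hopt⟩ := QMC.exists_tilt hb hc hγ hε
  set δ := 6 * (u * b) ^ 2 / (ε - 10 * (u * c)) with hδ
  have hstep : ∀ Y : QMC.Herm d,
      ‖QMC.weightedKraus K (fun i => Real.exp (u * f i)) Y‖ ≤ Real.exp (δ / 2) * ‖Y‖ := by
    intro Y
    have h := QMC.norm_weightedKraus_exp_sq_le hωn hK hK' hp0 hp1 hA hA' (Real.sqrt_nonneg (1 - ε))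
      hgap hcontr hb.le hf hfb (fun i => by
        rw [← hfc, ← Real.norm_eq_abs]
        exact norm_le_pi_norm f i) hc.le hu0 (by rw [hs2]; linarith) Y
    rw [hs2, sub_sub_cancel, ← hδ] at h
    refine (sq_le_sq₀ (norm_nonneg _) (by positivity)).1 (h.trans ?_)
    rw [mul_pow, ← Real.exp_nat_mul]
    refine mul_le_mul_of_nonneg_right ?_ (sq_nonneg _)
    have := Real.add_one_le_exp δ
    rw [show ((2 : ℕ) : ℝ) * (δ / 2) = δ by push_cast; ring]
    linarith
  have hiter := QMC.norm_iterate_le (Real.exp_pos _).le hstep n ω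
  rw [hωn, mul_one, ← Real.exp_nat_mul] at hiter
  have htr : (ρ * ((QMC.weightedKraus V fun i => Real.exp (u * f i))^[n] E).mat).trace.re =
      inner ℝ R ((QMC.weightedKraus K fun i => Real.exp (u * f i))^[n] ω) := by
    rw [QMC.Herm.inner_def, hR,
      QMC.iterate_weightedKraus_symmKraus ha hu V _ (X := E) (by rw [hω, hE, mul_one])]
    have : ∀ M : QMC.Mat d, (a⁻¹ * ρ * a⁻¹ * (a * M * a)).trace = (ρ * M).trace := fun M => by
      have : a⁻¹ * ρ * a⁻¹ * (a * M * a) = a⁻¹ * (ρ * M * a) := by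
        simp only [mul_assoc, nonsing_inv_mul_cancel_left _ _ hu]
      rw [this, trace_mul_comm, mul_assoc, mul_nonsing_inv _ hu, mul_one]
    rw [this]
  calc _ ≤ Real.exp (-(n * (u * γ))) *
        inner ℝ R ((QMC.weightedKraus K fun i => Real.exp (u * f i))^[n] ω) := by
        rw [← htr]
        exact QMC.measureReal_sum_ge_le V ρ P hX f hu0 γ hn hE
    _ ≤ Real.exp (-(n * (u * γ))) * (‖R‖ * Real.exp (n * (δ / 2))) := by
        refine mul_le_mul_of_nonneg_left ((real_inner_le_norm _ _).trans ?_) (Real.exp_pos _).le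
        exact mul_le_mul_of_nonneg_left hiter (norm_nonneg _)
    _ = ‖R‖ * Real.exp (n * (3 * (u * b) ^ 2 / (ε - 10 * (u * c)) - u * γ)) := by
        rw [mul_left_comm, ← Real.exp_add, hδ]
        congr 2
        ring
    _ = _ := by
        rw [hopt]
        congr 2
        ring
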